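/- A sequence of positive integers $w_1 < w_2 < \dots < w_n$ is called an *ascending wave* if $w_{i+1}-w_i \ge w_i-w_{i-1}$ for $2\le i\le n-1$. For integers $k,r\ge 1$ let $AW(k;r)$ be the least positive integer $N$ such that every $r$-coloring of $\{1,2,\dots,N\}$ admits a $k$-term monochromatic ascending wave. Then for each fixed integer $r\ge 1$ and each real $\epsilon>0$, for all sufficiently large integers $k$ (depending on $r$ and $\epsilon$), $$AW(k;r)\ \ge\ \frac{k^{2r-1-\epsilon}}{2^{r-1}(40r)^{r^2-1}}.$$ -/

import Mathlib

/-- `w 0, …, w (n - 1)` is an `n`-term ascending wave: a strictly increasing sequence of positive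
integers whose consecutive differences are non-decreasing. -/
def IsAscendingWave {n : ℕ} (w : Fin n → ℕ) : Prop :=
  (∀ i, 0 < w i) ∧ StrictMono w ∧
    ∀ (i : ℕ) (hi : i + 2 < n),
      (w ⟨i + 1, by omega⟩ : ℤ) - w ⟨i, by omega⟩ ≤ (w ⟨i + 2, hi⟩ : ℤ) - w ⟨i + 1, by omega⟩

/-- Every `r`-coloring of `[1, N]` admits a `k`-term monochromatic ascending wave in `[1, N]`.
A coloring of `[1, N]` is given as the restriction of a map on `ℕ`; only the values on `[1, N]`
are used. -/
def ForcesWave (k r N : ℕ) : Prop :=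
  ∀ χ : ℕ → Fin r, ∃ w : Fin k → ℕ,
    IsAscendingWave w ∧ (∀ i, w i ≤ N) ∧ ∃ c : Fin r, ∀ i, χ (w i) = c

/-- `AW k r` is the least positive integer `N` such that every `r`-coloring of `[1, N]` admits a
`k`-term monochromatic ascending wave. (The infimum would be `0` if no such `N` existed, so a
positive lower bound on `AW k r` includes the existence of such an `N`.) -/
noncomputable def AW (k r : ℕ) : ℕ :=
  sInf {N : ℕ | 0 < N ∧ ForcesWave k r N}

/-!
Induction on the number of colours. Cut the integers into blocks of length `B`, let a function `c`
choose one omitted colour for each block, and colour every block without its omitted colour by a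
colouring that has no `k'`-term wave, where `k'` is a little smaller than `k`. A counting argument
(`exists_meetsAllColors`) gives a `c` for which every arithmetic progression of `t` blocks omits
each colour somewhere; here `t` can be as small as any fixed power of `k`.

Consider a monochromatic wave of colour `i`. It avoids the blocks that omit `i`. While its
differences are below `B` it runs through consecutive blocks, fewer than `t` of them, so this lasts
for at most `t * k'` terms (`exists_color_of_short_steps`). After that the differences must keep
growing: if they stayed within `δ ≈ B / t ^ 4` of some `d ≥ B` for `3 * t ^ 3` steps, then Dirichlet
approximation would give `q ≤ t ^ 2` with `q * d` close to a multiple `m * B`, and the terms sampled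
with step `q`, reduced by a linear function with slope `m * B`, would form a convex sequence
oscillating by less than `B`. Such a sequence stays in one block for a third of the time, so `t` of
the sampled terms would lie in blocks forming an arithmetic progression
(`exists_color_of_slow`). Hence after about `k / t ^ 5` rounds the differences have size about
`B * k` up to powers of `t`, and the remaining terms span a length `B * k ^ 2` up to powers of `t`.
So each new colour gains a factor `k ^ 2` up to powers of `t`, and `t` is a negligible power
of `k`.
-/

/-! ### Convex integer sequences -/

/-- The differences of `X 0, …, X (n - 1)` are non-decreasing. -/
def HasMonoDiffs (X : ℕ → ℤ) (n : ℕ) : Prop :=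
  ∀ i, i + 2 < n → X (i + 1) - X i ≤ X (i + 2) - X (i + 1)

namespace HasMonoDiffs

variable {X : ℕ → ℤ} {n : ℕ}

lemma diff_le (hX : HasMonoDiffs X n) {i j : ℕ} (hij : i ≤ j) (hj : j + 1 < n) :
    X (i + 1) - X i ≤ X (j + 1) - X j := by
  induction j, hij using Nat.le_induction with
  | base => exact le_rfl
  | succ j hij ih => exact (ih (by omega)).trans (hX j hj)

lemma le_gap (hX : HasMonoDiffs X n) {i j q : ℕ} (hij : i ≤ j) (hj : j + q < n) :
    q * (X (i + 1) - X i) ≤ X (j + q) - X j := by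
  induction q with
  | zero => simp
  | succ q ih =>
    have h1 := ih (by omega)
    have h2 := hX.diff_le (show i ≤ j + q by omega) (by omega)
    rw [← add_assoc]
    push_cast
    linarith

lemma gap_le (hX : HasMonoDiffs X n) {i j q : ℕ} (hij : j + q ≤ i + 1) (hi : i + 1 < n) :
    X (j + q) - X j ≤ q * (X (i + 1) - X i) := by
  induction q with
  | zero => simp
  | succ q ih =>
    have h1 := ih (by omega)
    have h2 := hX.diff_le (show j + q ≤ i by omega) hi
    rw [← add_assoc]
    push_cast
    linarith

lemma gap_mono (hX : HasMonoDiffs X n) {i j q : ℕ} (hij : i ≤ j) (hj : j + q < n) :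
    X (i + q) - X i ≤ X (j + q) - X j := by
  induction q with
  | zero => simp
  | succ q ih =>
    have h1 := ih (by omega)
    have h2 := hX.diff_le (show i + q ≤ j + q by omega) (by omega)
    rw [← add_assoc, ← add_assoc]
    linarith

/-- Sampling along an arithmetic progression of indices and subtracting a linear function keeps
differences non-decreasing. -/
lemma sample (hX : HasMonoDiffs X n) {p q L : ℕ} (hL : p + q * L < n) (e : ℤ) :
    HasMonoDiffs (fun j ↦ X (p + q * j) - j * e) (L + 1) := by
  intro i hi
  have hle : q * (i + 2) ≤ q * L := Nat.mul_le_mul_left q (by omega)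
  have h := hX.gap_mono (i := p + q * i) (j := p + q * (i + 1)) (q := q)
    (by nlinarith) (by nlinarith)
  have e1 : p + q * i + q = p + q * (i + 1) := by ring
  have e2 : p + q * (i + 1) + q = p + q * (i + 2) := by ring
  rw [e1, e2] at h
  push_cast
  linarith

lemma le_max (hX : HasMonoDiffs X n) {a j b : ℕ} (haj : a ≤ j) (hjb : j ≤ b) (hb : b < n) :
    X j ≤ max (X a) (X b) := by
  obtain ⟨s, rfl⟩ := Nat.exists_eq_add_of_le haj
  obtain ⟨u, rfl⟩ := Nat.exists_eq_add_of_le hjb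
  rcases Nat.eq_zero_or_pos u with rfl | hu
  · simp
  rcases le_total 0 (X (a + s + 1) - X (a + s)) with h | h
  · have := hX.le_gap (le_refl (a + s)) hb
    have h0 : 0 ≤ (u : ℤ) * (X (a + s + 1) - X (a + s)) := by positivity
    exact le_max_of_le_right (by linarith)
  · have := hX.gap_le (i := a + s) (j := a) (q := s) (by omega) (by omega)
    have h0 : (s : ℤ) * (X (a + s + 1) - X (a + s)) ≤ 0 :=
      mul_nonpos_of_nonneg_of_nonpos (by positivity) h
    exact le_max_of_le_left (by linarith)

/-- A convex sequence of `3 * t` integers that oscillates by less than `B` stays in a single block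
`[f * B, (f + 1) * B)` for `t` consecutive indices: it meets at most two blocks, and the indices
where it lies in the lower one form an interval. -/
lemma exists_const_block {v : ℕ → ℤ} {t : ℕ} (ht : 0 < t) (hv : HasMonoDiffs v (3 * t))
    {B : ℤ} (hB : 0 < B) (hosc : ∀ i < 3 * t, ∀ j < 3 * t, v i - v j < B) :
    ∃ a, a + t ≤ 3 * t ∧ ∃ f, ∀ j < t, v (a + j) / B = f := by
  obtain ⟨s, hs, hmin⟩ := Finset.exists_min_image (Finset.range (3 * t)) v ⟨0, by simp [ht]⟩
  simp only [Finset.mem_range] at hs hmin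
  set f := v s / B
  have hfs : f * B ≤ v s := Int.ediv_mul_le _ hB.ne'
  have hfs' : v s < (f + 1) * B := Int.lt_ediv_add_one_mul_self _ hB
  have hlow : ∀ j < 3 * t, v j < (f + 1) * B → v j / B = f := fun j hj h ↦
    Int.ediv_eq_iff_of_pos hB |>.2 ⟨by nlinarith [hmin j hj], by nlinarith⟩
  have hhigh : ∀ j < 3 * t, (f + 1) * B ≤ v j → v j / B = f + 1 := fun j hj h ↦
    Int.ediv_eq_iff_of_pos hB |>.2 ⟨by nlinarith, by nlinarith [hosc j hj s hs]⟩
  by_cases h1 : ∃ i < t, v i < (f + 1) * B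
  · by_cases h2 : ∃ i < t, v (2 * t + i) < (f + 1) * B
    · obtain ⟨i, hi, hvi⟩ := h1
      obtain ⟨l, hl, hvl⟩ := h2
      refine ⟨t, by omega, f, fun j hj ↦ hlow _ (by omega) ?_⟩
      exact (hv.le_max (a := i) (b := 2 * t + l) (by omega) (by omega) (by omega)).trans_lt
        (max_lt hvi hvl)
    · push Not at h2
      exact ⟨2 * t, by omega, f + 1, fun j hj ↦ hhigh _ (by omega) (h2 j hj)⟩
  · push Not at h1
    exact ⟨0, by omega, f + 1, fun j hj ↦ hhigh _ (by omega) (by simpa using h1 j hj)⟩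

end HasMonoDiffs

/-! ### Colourings that meet every long progression -/

/-- Every `t`-term arithmetic progression in `[0, M)` with positive difference contains every
colour of `c`. -/
def MeetsAllColors {R : ℕ} (c : ℤ → Fin R) (t : ℕ) (M : ℤ) : Prop :=
  ∀ a m : ℤ, 0 ≤ a → 0 < m → a + (t - 1) * m < M → ∀ i, ∃ j : ℕ, j < t ∧ c (a + j * m) = i

lemma card_avoid {M r : ℕ} (A : Finset (Fin M)) (i : Fin (r + 1)) :
    (Finset.univ.filter fun c : Fin M → Fin (r + 1) ↦ ∀ x ∈ A, c x ≠ i).card * (r + 1) ^ A.card =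
      r ^ A.card * (r + 1) ^ M := by
  have h : (Finset.univ.filter fun c : Fin M → Fin (r + 1) ↦ ∀ x ∈ A, c x ≠ i) =
      Fintype.piFinset fun x ↦ if x ∈ A then Finset.univ.erase i else Finset.univ := by
    ext c
    simp only [Finset.mem_filter, Finset.mem_univ, true_and, Fintype.mem_piFinset]
    refine forall_congr' fun x ↦ ?_
    by_cases hx : x ∈ A <;> simp [hx]
  have hA : A.card + Aᶜ.card = M := by simp
  rw [h, Fintype.card_piFinset]
  have : ∀ x, (if x ∈ A then Finset.univ.erase i else (Finset.univ : Finset (Fin (r + 1)))).card =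
      if x ∈ A then r else r + 1 := by
    intro x
    split_ifs <;> simp
  simp only [this]
  rw [Finset.prod_ite, Finset.prod_const, Finset.prod_const]
  have e1 : (Finset.univ.filter fun x ↦ x ∈ A) = A := by ext; simp
  have e2 : (Finset.univ.filter fun x ↦ x ∉ A) = Aᶜ := by ext; simp
  rw [e1, e2, mul_assoc, ← pow_add, add_comm Aᶜ.card, hA]

/-- The union bound: a colouring chosen at random misses a given colour on a given progression
with probability `(r / (r + 1)) ^ t`. -/
lemma exists_meetsAllColors {r t M : ℕ} (ht : 2 ≤ t)
    (h : (r + 1) * M ^ 2 * r ^ t < (r + 1) ^ t) :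
    ∃ c : ℤ → Fin (r + 1), MeetsAllColors c t M := by
  classical
  by_contra! hno
  -- Only the values on `[0, M)` matter for `ext c`; elsewhere it is `0`.
  let ext : (Fin M → Fin (r + 1)) → ℤ → Fin (r + 1) := fun c z ↦
    if hz : z.toNat < M then c ⟨z.toNat, hz⟩ else 0
  let AP : Fin M × Fin M → Finset (Fin M) := fun p ↦
    Finset.univ.filter fun x ↦ ∃ j < t, (x : ℕ) = p.1 + j * p.2
  let bad : (Fin M × Fin M) × Fin (r + 1) → Finset (Fin M → Fin (r + 1)) := fun p ↦
    if (AP p.1).card = t then Finset.univ.filter fun c ↦ ∀ x ∈ AP p.1, c x ≠ p.2 else ∅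
  have hbad : ∀ p, (bad p).card * (r + 1) ^ t ≤ r ^ t * (r + 1) ^ M := by
    intro p
    by_cases hp : (AP p.1).card = t
    · simp only [bad, hp, if_true]
      have := card_avoid (AP p.1) p.2
      rw [hp] at this
      exact this.le
    · simp [bad, hp]
  have hcover : (Finset.univ : Finset (Fin M → Fin (r + 1))) ⊆ Finset.univ.biUnion bad := by
    intro c _
    have hc := hno (ext c)
    simp only [MeetsAllColors] at hc
    push Not at hc
    obtain ⟨a, m, ha, hm, ham, i, hi⟩ := hc
    lift a to ℕ using ha
    lift m to ℕ using hm.le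
    have hm' : 0 < m := by exact_mod_cast hm
    obtain ⟨u, rfl⟩ : ∃ u, t = u + 2 := ⟨t - 2, by omega⟩
    have ham' : a + (u + 1) * m < M := by
      have : ((a + (u + 1) * m : ℕ) : ℤ) < M := by push_cast at ham ⊢; linarith
      exact_mod_cast this
    have hlt : ∀ j < u + 2, a + j * m < M := fun j hj ↦
      lt_of_le_of_lt (by gcongr; omega) ham'
    have haM : a < M := by nlinarith
    have hmM : m < M := by nlinarith
    have hcard : (AP (⟨a, haM⟩, ⟨m, hmM⟩)).card = u + 2 := by
      have : AP (⟨a, haM⟩, ⟨m, hmM⟩) = Finset.univ.image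
          fun j : Fin (u + 2) ↦ (⟨a + j * m, hlt j j.2⟩ : Fin M) := by
        ext x
        simp only [AP, Finset.mem_filter, Finset.mem_univ, true_and, Finset.mem_image, Fin.ext_iff]
        constructor
        · rintro ⟨j, hj, hx⟩
          exact ⟨⟨j, hj⟩, hx.symm⟩
        · rintro ⟨j, hx⟩
          exact ⟨j, j.2, hx.symm⟩
      rw [this, Finset.card_image_of_injective, Finset.card_univ, Fintype.card_fin]
      intro j l hjl
      simp only [Fin.mk.injEq, add_right_inj] at hjl
      exact Fin.ext (Nat.eq_of_mul_eq_mul_right hm' hjl)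
    refine Finset.mem_biUnion.2 ⟨((⟨a, haM⟩, ⟨m, hmM⟩), i), Finset.mem_univ _, ?_⟩
    simp only [bad, hcard, if_true, Finset.mem_filter, Finset.mem_univ, true_and]
    intro x hx
    simp only [AP, Finset.mem_filter, Finset.mem_univ, true_and] at hx
    obtain ⟨j, hj, hx⟩ := hx
    have := hi j hj
    have e : ((a : ℤ) + j * m).toNat = x := by rw [hx]; norm_cast
    simpa [ext, e] using this
  have h1 : (r + 1) ^ M ≤ ∑ p, (bad p).card := by
    have := (Finset.card_le_card hcover).trans Finset.card_biUnion_le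
    simpa using this
  have h2 : (r + 1) ^ M * (r + 1) ^ t ≤ (M * M * (r + 1)) * (r ^ t * (r + 1) ^ M) := by
    calc (r + 1) ^ M * (r + 1) ^ t ≤ (∑ p, (bad p).card) * (r + 1) ^ t := by gcongr
      _ = ∑ p, (bad p).card * (r + 1) ^ t := Finset.sum_mul ..
      _ ≤ ∑ _p : (Fin M × Fin M) × Fin (r + 1), r ^ t * (r + 1) ^ M :=
        Finset.sum_le_sum fun p _ ↦ hbad p
      _ = _ := by simp
  have h3 := Nat.mul_lt_mul_of_pos_left h (show 0 < (r + 1) ^ M by positivity)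
  have h4 : (r + 1) ^ M * ((r + 1) * M ^ 2 * r ^ t) =
    (M * M * (r + 1)) * (r ^ t * (r + 1) ^ M) := by ring
  omega

/-- Exponential beats polynomial: progressions of length `t` suffice in `[0, t ^ s)`. -/
lemma exists_meetsAllColors_of_large (r s : ℕ) :
    ∃ t₀, ∀ t ≥ t₀, ∃ c : ℤ → Fin (r + 1), MeetsAllColors c t ((t ^ s : ℕ) : ℤ) := by
  have hlim := (tendsto_pow_const_mul_const_pow_of_abs_lt_one (2 * s)
    (r := (r : ℝ) / (r + 1)) (by
      rw [abs_of_nonneg (by positivity), div_lt_one (by positivity)]; linarith)).const_mul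
      ((r : ℝ) + 1)
  rw [mul_zero] at hlim
  obtain ⟨t₁, ht₁⟩ := Filter.eventually_atTop.1 (hlim.eventually_lt_const one_pos)
  refine ⟨max t₁ 2, fun t ht ↦ exists_meetsAllColors (le_of_max_le_right ht) ?_⟩
  have h := ht₁ t (le_of_max_le_left ht)
  rw [div_pow, ← mul_div_assoc, ← mul_div_assoc, div_lt_one (by positivity)] at h
  have : ((r + 1) * (t ^ s) ^ 2 * r ^ t : ℝ) < (r + 1) ^ t := by
    rw [← pow_mul, mul_comm s 2]; linarith
  exact_mod_cast this

/-! ### Convex sequences and blocks -/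

/-- A stretch of a sequence with differences at least `B` that hardly vary meets a block of every
colour: by Dirichlet's theorem some multiple `q * d` of the difference is close to a multiple
`m * B` of the block length, and then `t` of the terms sampled with step `q` lie in blocks that
form an arithmetic progression with difference `m`. -/
lemma exists_color_of_slow {R t n : ℕ} (ht : 7 ≤ t) {B M : ℤ} (hB : 0 < B) {c : ℤ → Fin R}
    (hc : MeetsAllColors c t M) {X : ℕ → ℤ} (hX : HasMonoDiffs X n)
    (hrange : ∀ i < n, 0 ≤ X i ∧ X i < B * M) {p : ℕ} (hp : p + 3 * t ^ 3 + 1 < n) {δ : ℤ}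
    (hδ : δ * t ^ 4 ≤ B) (hd : B ≤ X (p + 1) - X p)
    (hslow : X (p + 3 * t ^ 3 + 1) - X (p + 3 * t ^ 3) ≤ X (p + 1) - X p + δ) (i : Fin R) :
    ∃ j < n, c (X j / B) = i := by
  set d := X (p + 1) - X p
  have hδ0 : 0 ≤ δ := by
    have := hX.diff_le (show p ≤ p + 3 * t ^ 3 by omega) hp
    linarith
  have ht0 : (0 : ℤ) < t := by positivity
  have ht7 : (7 : ℤ) ≤ t := by exact_mod_cast ht
  obtain ⟨q, hq0, hqt, hq⟩ := Real.exists_nat_abs_mul_sub_round_le ((d : ℝ) / B)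
    (n := t ^ 2) (by positivity)
  set m : ℤ := round ((q : ℝ) * ((d : ℝ) / B))
  have hBR : (0 : ℝ) < B := by exact_mod_cast hB
  have hclose : |(q : ℤ) * d - m * B| * t ^ 2 ≤ B := by
    have h1 : |(q : ℝ) * d - m * B| ≤ 1 / (((t ^ 2 : ℕ) : ℝ) + 1) * B := by
      have e : (q : ℝ) * d - m * B = ((q : ℝ) * ((d : ℝ) / B) - m) * B := by field_simp
      rw [e, abs_mul, abs_of_pos hBR]
      gcongr
    have h2 : |(q : ℝ) * d - m * B| * (t : ℝ) ^ 2 ≤ (B : ℝ) := by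
      calc |(q : ℝ) * d - m * B| * (t : ℝ) ^ 2 ≤
          (1 / (((t ^ 2 : ℕ) : ℝ) + 1) * B) * (t : ℝ) ^ 2 := by gcongr
        _ = B * ((t : ℝ) ^ 2 / ((t : ℝ) ^ 2 + 1)) := by push_cast; ring
        _ ≤ (B : ℝ) * 1 := by
          gcongr
          rw [div_le_one (by positivity)]; linarith
        _ = B := mul_one _
    exact_mod_cast h2
  -- These inequalities are multiplied by `t ^ 2` to stay within the integers.
  have hlo : -B ≤ ((q : ℤ) * d - m * B) * t ^ 2 := by
    nlinarith [neg_abs_le ((q : ℤ) * d - m * B), sq_nonneg (t : ℤ)]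
  have hhi : ((q : ℤ) * d - m * B) * t ^ 2 ≤ B := by
    nlinarith [le_abs_self ((q : ℤ) * d - m * B), sq_nonneg (t : ℤ)]
  have hqZ : (q : ℤ) ≤ t ^ 2 := by exact_mod_cast hqt
  have hq1 : (1 : ℤ) ≤ q := by exact_mod_cast hq0
  have ht2 : (1 : ℤ) < t ^ 2 := by nlinarith
  have hm0 : 0 < m := by
    by_contra! hm0
    have h1 : B ≤ q * d := by nlinarith
    have h2 : m * B ≤ 0 := mul_nonpos_of_nonpos_of_nonneg hm0 hB.le
    nlinarith
  have hqδ : (q : ℤ) * δ * t ^ 2 ≤ B := by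
    calc (q : ℤ) * δ * t ^ 2 ≤ t ^ 2 * δ * t ^ 2 := by gcongr
      _ = δ * t ^ 4 := by ring
      _ ≤ B := hδ
  have hidx : q * (3 * t) ≤ 3 * t ^ 3 := by
    calc q * (3 * t) ≤ t ^ 2 * (3 * t) := by gcongr
      _ = 3 * t ^ 3 := by ring
  set v : ℕ → ℤ := fun j ↦ X (p + q * j) - j * (m * B) with hv
  have hvconv : HasMonoDiffs v (3 * t) := fun j hj ↦
    hX.sample (p := p) (q := q) (L := 3 * t) (by omega) (m * B) j (by omega)
  have hosc' : ∀ a l, a + l < 3 * t →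
      -(l * B) ≤ (v (a + l) - v a) * t ^ 2 ∧ (v (a + l) - v a) * t ^ 2 ≤ 2 * l * B := by
    intro a l hal
    have hle : q * (a + l) ≤ q * (3 * t) := Nat.mul_le_mul_left q hal.le
    have e : p + q * (a + l) = p + q * a + q * l := by ring
    have h1 := hX.le_gap (i := p) (j := p + q * a) (q := q * l) (by omega) (by
      rw [← e]; omega)
    have h2 := hX.gap_le (i := p + 3 * t ^ 3) (j := p + q * a) (q := q * l) (by
      rw [← e]; omega) hp
    rw [← e] at h1 h2
    have h2' : X (p + q * (a + l)) - X (p + q * a) ≤ (q * l : ℕ) * (d + δ) :=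
      h2.trans (by gcongr)
    have hvv : v (a + l) - v a = X (p + q * (a + l)) - X (p + q * a) - l * (m * B) := by
      simp only [hv]; push_cast; ring
    push_cast at h1 h2'
    rw [hvv]
    constructor
    · calc -(l * B) = l * (-B) := by ring
        _ ≤ l * (((q : ℤ) * d - m * B) * t ^ 2) := by gcongr
        _ = (q * l * d - l * (m * B)) * t ^ 2 := by ring
        _ ≤ _ := by gcongr
    · calc _ ≤ (q * l * (d + δ) - l * (m * B)) * (t : ℤ) ^ 2 := by gcongr
        _ = l * (((q : ℤ) * d - m * B) * t ^ 2) + l * (q * δ * t ^ 2) := by ring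
        _ ≤ l * B + l * B := by gcongr
        _ = 2 * l * B := by ring
  have hosc : ∀ a < 3 * t, ∀ b < 3 * t, v a - v b < B := by
    intro a ha b hb
    have key : (v a - v b) * t ^ 2 ≤ 6 * t * B := by
      rcases le_total a b with hab | hab
      · obtain ⟨l, rfl⟩ := Nat.exists_eq_add_of_le hab
        have := (hosc' a l hb).1
        have hl : (l : ℤ) ≤ 3 * t := by exact_mod_cast (by omega : l ≤ 3 * t)
        nlinarith
      · obtain ⟨l, rfl⟩ := Nat.exists_eq_add_of_le hab
        have := (hosc' b l ha).2
        have hl : (l : ℤ) ≤ 3 * t := by exact_mod_cast (by omega : l ≤ 3 * t)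
        nlinarith
    by_contra! hcon
    have h1 : B * (t : ℤ) ^ 2 ≤ 6 * t * B :=
      (mul_le_mul_of_nonneg_right hcon (by positivity)).trans key
    have h2 : 0 < t * B := by positivity
    nlinarith
  obtain ⟨a, ha, f, hf⟩ := hvconv.exists_const_block (by omega) hB hosc
  have hblock : ∀ j < t, X (p + q * (a + j)) / B = f + a * m + j * m := by
    intro j hj
    have e : X (p + q * (a + j)) = v (a + j) + (a * m + j * m) * B := by
      simp only [hv]; push_cast; ring
    rw [e, Int.add_mul_ediv_right _ _ hB.ne', hf j hj]; ring
  have hin : ∀ j < t, p + q * (a + j) < n := by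
    intro j hj
    have : q * (a + j) ≤ q * (3 * t) := Nat.mul_le_mul_left q (by omega)
    omega
  have hb0 : 0 ≤ f + a * m := by
    have h := hblock 0 (by omega)
    have h' := Int.ediv_nonneg (hrange _ (hin 0 (by omega))).1 hB.le
    rw [h] at h'
    simpa using h'
  have hb1 : f + a * m + (t - 1) * m < M := by
    have h := hblock (t - 1) (by omega)
    have h' := Int.ediv_lt_of_lt_mul hB
      (by simpa [mul_comm] using (hrange _ (hin (t - 1) (by omega))).2)
    rw [h, Nat.cast_sub (by omega)] at h'
    exact_mod_cast h'
  obtain ⟨j, hj, hji⟩ := hc _ m hb0 hm0 hb1 i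
  exact ⟨_, hin j hj, by rw [hblock j hj]; exact hji⟩

/-- While its differences are below the block length, a sequence visits consecutive blocks, so
that among `t` of them it meets every colour. -/
lemma exists_color_of_short_steps {R t k n : ℕ} {B M : ℤ} (hB : 0 < B) {c : ℤ → Fin R}
    (hc : MeetsAllColors c t M) {X : ℕ → ℤ} (hrange : ∀ i < n, 0 ≤ X i ∧ X i < B * M)
    (hn : t * k < n)
    (hblock : ∀ i, i + k < n → X i / B < X (i + k) / B)
    (hshort : ∀ i < t * k, X (i + 1) - X i < B) (i : Fin R) :
    ∃ j < n, c (X j / B) = i := by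
  have hstep : ∀ j < t * k, X (j + 1) / B ≤ X j / B + 1 := by
    intro j hj
    have h1 : X (j + 1) ≤ X j + 1 * B := by linarith [hshort j hj]
    have h2 := Int.ediv_le_ediv hB h1
    rwa [Int.add_mul_ediv_right _ _ hB.ne'] at h2
  have hfar : ∀ s ≤ t, X 0 / B + s ≤ X (s * k) / B := by
    intro s hs
    induction s with
    | zero => simp
    | succ s ih =>
      have hle : (s + 1) * k ≤ t * k := Nat.mul_le_mul_right k hs
      rw [Nat.succ_mul] at hle ⊢
      have h1 := hblock (s * k) (by omega)
      have h2 := ih (by omega)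
      push_cast
      omega
  -- a discrete intermediate value property
  have hivt : ∀ l ≤ t * k, ∀ b, X 0 / B ≤ b → b ≤ X l / B → ∃ j ≤ l, X j / B = b := by
    intro l
    induction l with
    | zero => exact fun _ b h1 h2 ↦ ⟨0, le_rfl, le_antisymm h1 h2⟩
    | succ l ih =>
      intro hl b h1 h2
      by_cases hb : b ≤ X l / B
      · obtain ⟨j, hj, h⟩ := ih (by omega) b h1 hb
        exact ⟨j, by omega, h⟩
      · have := hstep l (by omega)
        exact ⟨l + 1, le_rfl, by omega⟩
  have hend := hfar t le_rfl
  have hM := Int.ediv_lt_of_lt_mul hB (by simpa [mul_comm] using (hrange _ hn).2)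
  obtain ⟨j, hj, hji⟩ := hc (X 0 / B) 1 (Int.ediv_nonneg (hrange 0 (by omega)).1 hB.le) one_pos
    (by omega) i
  obtain ⟨l, hl, hlb⟩ := hivt (t * k) le_rfl (X 0 / B + j) (by omega) (by omega)
  exact ⟨l, by omega, by rw [hlb]; simpa using hji⟩

/-- A long convex sequence in `[0, B * M)` that spends fewer than `k` consecutive terms in any
block meets blocks of every colour: otherwise its differences exceed `B` after `t * k` terms and
grow by `δ` every `3 * t ^ 3` terms from then on. -/
lemma exists_color_of_long {R t k n P S : ℕ} (ht : 7 ≤ t) {B M : ℤ} (hB : 0 < B)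
    {c : ℤ → Fin R} (hc : MeetsAllColors c t M) {X : ℕ → ℤ} (hX : HasMonoDiffs X n)
    (hrange : ∀ i < n, 0 ≤ X i ∧ X i < B * M)
    (hblock : ∀ i, i + k < n → X i / B < X (i + k) / B) {δ : ℤ} (hδ : δ * t ^ 4 ≤ B)
    (hn : t * k + P * (3 * t ^ 3) + S + 1 < n) (hM : B * M ≤ S * (P * δ)) (i : Fin R) :
    ∃ j < n, c (X j / B) = i := by
  by_contra! hcon
  have hstart : B ≤ X (t * k + 1) - X (t * k) := by
    by_contra! hlt
    obtain ⟨j, hj, hji⟩ := exists_color_of_short_steps hB hc hrange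
      (by omega : t * k < n) hblock
      (fun j hj ↦ (hX.diff_le hj.le (by omega)).trans_lt hlt) i
    exact hcon j hj hji
  have hgrow : ∀ s ≤ P, B + s * δ ≤
      X (t * k + s * (3 * t ^ 3) + 1) - X (t * k + s * (3 * t ^ 3)) := by
    intro s hs
    induction s with
    | zero => simpa using hstart
    | succ s ih =>
      have hle : (s + 1) * (3 * t ^ 3) ≤ P * (3 * t ^ 3) := Nat.mul_le_mul_right _ hs
      rw [Nat.succ_mul] at hle ⊢
      rw [← add_assoc]
      have h1 := ih (by omega)
      have h2 : B ≤ X (t * k + s * (3 * t ^ 3) + 1) - X (t * k + s * (3 * t ^ 3)) :=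
        hstart.trans (hX.diff_le (by omega) (by omega))
      by_contra! hlt
      push_cast at hlt
      obtain ⟨j, hj, hji⟩ := exists_color_of_slow ht hB hc hX hrange
        (p := t * k + s * (3 * t ^ 3)) (by omega) hδ h2 (by linarith) i
      exact hcon j hj hji
  have h1 := hgrow P le_rfl
  have h2 := hX.le_gap (le_refl (t * k + P * (3 * t ^ 3))) (q := S) (by omega)
  have h3 := (hrange (t * k + P * (3 * t ^ 3) + S) (by omega)).2
  have h4 := (hrange (t * k + P * (3 * t ^ 3)) (by omega)).1
  have h5 : (S : ℤ) * (P * δ) ≤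
      S * (X (t * k + P * (3 * t ^ 3) + 1) - X (t * k + P * (3 * t ^ 3))) := by
    gcongr
    linarith
  linarith

/-! ### Waves in colourings -/

lemma ForcesWave.mono {k r N N' : ℕ} (h : ForcesWave k r N) (hN : N ≤ N') : ForcesWave k r N' :=
  fun χ ↦ let ⟨w, hw, hle, hc⟩ := h χ
    ⟨w, hw, fun i ↦ (hle i).trans hN, hc⟩

lemma ForcesWave.le {k r N : ℕ} (h : ForcesWave k (r + 1) N) : k ≤ N := by
  obtain ⟨w, ⟨hpos, hw, -⟩, hle, -⟩ := h fun _ ↦ 0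
  have := Finset.card_le_card_of_injOn (s := Finset.univ) (t := Finset.Icc 1 N) w
    (fun i _ ↦ by simpa using ⟨hpos i, hle i⟩) hw.injective.injOn
  simpa using this

/-- Van der Waerden's theorem, in the form needed here: a monochromatic combinatorial line in a
cube over `Fin k`, mapped to the positive integers by summing coordinates, is a `k`-term arithmetic
progression. -/
lemma exists_forcesWave (k r : ℕ) : ∃ N, 0 < N ∧ ForcesWave k r N := by
  obtain ⟨ι, _, hι⟩ := Combinatorics.Line.exists_mono_in_high_dimension (Fin k) (Fin r)
  refine ⟨1 + Fintype.card ι * k, by omega, fun χ ↦ ?_⟩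
  obtain ⟨l, c, hc⟩ := hι fun x ↦ χ (1 + ∑ i, (x i : ℕ))
  set A := ∑ i, (l.idxFun i).elim 0 Fin.val with hA
  set D := (Finset.univ.filter fun i ↦ l.idxFun i = none).card with hD
  have hsum : ∀ x : Fin k, ∑ i, (l x i : ℕ) = A + D * x := by
    intro x
    rw [hA, hD, Finset.card_filter, Finset.sum_mul, ← Finset.sum_add_distrib]
    refine Finset.sum_congr rfl fun i _ ↦ ?_
    cases h : l.idxFun i <;> simp [Combinatorics.Line.coe_apply, h]
  have hD0 : 0 < D := by
    obtain ⟨i, hi⟩ := l.proper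
    exact Finset.card_pos.2 ⟨i, by simpa using hi⟩
  refine ⟨fun x ↦ 1 + ∑ i, (l x i : ℕ),
    ⟨fun x ↦ Nat.add_pos_left one_pos _, fun x y hxy ↦ ?_, fun i hi ↦ ?_⟩, fun x ↦ ?_, c,
    fun x ↦ hc x⟩
  · simp only [hsum]
    have : (x : ℕ) < y := hxy
    gcongr
  · simp only [hsum]
    push_cast
    linarith
  · have : ∑ i, (l x i : ℕ) ≤ ∑ _i : ι, k := Finset.sum_le_sum fun i _ ↦ (l x i).2.le
    exact Nat.add_le_add_left (by simpa using this) 1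

/-! ### The recursive colouring -/

/-- The block colouring: cut the integers into blocks of length `B`; in the block number `b`, omit
the colour `c b` and use a colouring without `k'`-term waves for the other colours. A wave of
colour `i` then avoids all the blocks `b` with `c b = i`. -/
lemma not_forcesWave_of_blocks {r t k k' B M P S δ : ℕ} (ht : 7 ≤ t) (hB : 0 < B)
    {c : ℤ → Fin (r + 1)} (hc : MeetsAllColors c t M) (hno : ¬ForcesWave k' r B)
    (hδ : δ * t ^ 4 ≤ B) (hk : t * k' + P * (3 * t ^ 3) + S + 1 < k)
    (hM : B * M ≤ S * (P * δ)) : ¬ForcesWave k (r + 1) (B * M) := by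
  intro hforce
  simp only [ForcesWave] at hno
  push Not at hno
  obtain ⟨χ, hχ⟩ := hno
  obtain ⟨w, ⟨hpos, hw, hconv⟩, hle, i, hi⟩ :=
    hforce fun x ↦ (c ((x - 1) / B : ℕ)).succAbove (χ ((x - 1) % B + 1))
  set Y : ℕ → ℕ := fun j ↦ if h : j < k then w ⟨j, h⟩ - 1 else 0 with hY
  have hYw : ∀ j (h : j < k), w ⟨j, h⟩ = Y j + 1 := by
    intro j h
    have := hpos ⟨j, h⟩
    simp only [hY, h, dif_pos]
    omega
  have hYlt : ∀ a b, a < b → b < k → Y a < Y b := by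
    intro a b hab hb
    have := hw (show (⟨a, by omega⟩ : Fin k) < ⟨b, hb⟩ from hab)
    rw [hYw, hYw] at this
    omega
  have hYconv : HasMonoDiffs (fun j ↦ (Y j : ℤ)) k := by
    intro j hj
    have := hconv j hj
    rw [hYw, hYw, hYw] at this
    push_cast at this
    linarith
  have hYcol : ∀ j < k, (c (Y j / B : ℕ)).succAbove (χ (Y j % B + 1)) = i := by
    intro j hj
    have := hi ⟨j, hj⟩
    simpa [hYw j hj] using this
  have hrange : ∀ j < k, 0 ≤ (Y j : ℤ) ∧ (Y j : ℤ) < (B : ℤ) * M := by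
    intro j hj
    have := hle ⟨j, hj⟩
    rw [hYw j hj] at this
    exact ⟨by positivity, by exact_mod_cast this⟩
  have hblock : ∀ j, j + k' < k → (Y j : ℤ) / B < (Y (j + k') : ℤ) / B := by
    intro j hj
    norm_cast
    by_contra! hle'
    have hYle : ∀ a b, a ≤ b → b < k → Y a ≤ Y b := fun a b hab hb ↦ by
      rcases hab.eq_or_lt with rfl | h
      exacts [le_rfl, (hYlt a b h hb).le]
    have hsame : ∀ s ≤ k', Y (j + s) / B = Y j / B := fun s hs ↦ le_antisymm
      ((Nat.div_le_div_right (hYle _ _ (by omega) hj)).trans hle')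
      (Nat.div_le_div_right (hYle _ _ (by omega) (by omega)))
    have hdecomp : ∀ s ≤ k', Y (j + s) = B * (Y j / B) + Y (j + s) % B := fun s hs ↦ by
      rw [← hsame s hs, Nat.div_add_mod]
    have hwave : IsAscendingWave fun s : Fin k' ↦ Y (j + s) % B + 1 := by
      refine ⟨fun s ↦ Nat.succ_pos _, fun a b hab ↦ ?_, fun a ha ↦ ?_⟩
      · have h1 := hYlt (j + a) (j + b) (by have : (a : ℕ) < b := hab; omega) (by omega)
        have h2 := hdecomp a (by omega)
        have h3 := hdecomp b (by omega)
        simp only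
        omega
      · have h0 := hYconv (j + a) (by omega)
        have h1 := hdecomp a (by omega)
        have h2 := hdecomp (a + 1) (by omega)
        have h3 := hdecomp (a + 2) (by omega)
        simp only [add_assoc] at h0 ⊢
        zify at h1 h2 h3
        push_cast
        linarith
    obtain ⟨s, hs⟩ := hχ _ hwave (fun s ↦ Nat.mod_lt _ hB) (χ (Y j % B + 1))
    refine hs (Fin.succAbove_right_injective (p := c (Y j / B : ℕ)) ?_)
    rw [hYcol j (by omega)]
    have := hYcol (j + s) (by omega)
    rwa [hsame s (by omega)] at this
  obtain ⟨j, hj, hji⟩ := exists_color_of_long (B := B) (M := M) (δ := δ) ht (by exact_mod_cast hB)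
    hc hYconv hrange hblock (by exact_mod_cast hδ) hk (by exact_mod_cast hM) i
  have := hYcol j hj
  push_cast at this
  rw [hji] at this
  exact Fin.succAbove_ne _ _ this

/-! ### The lower bound -/

lemma MeetsAllColors.anti {R t : ℕ} {c : ℤ → Fin R} {M M' : ℤ} (hc : MeetsAllColors c t M')
    (h : M ≤ M') : MeetsAllColors c t M :=
  fun a m ha hm ham ↦ hc a m ha hm (ham.trans_le h)

lemma le_div_mul_mul {a b t : ℕ} (hb : 0 < b) (hab : b ≤ a) (ht : 2 ≤ t) :
    a ≤ a / b * (b * t) := by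
  have h1 := Nat.div_add_mod a b
  have h2 := Nat.mod_lt a hb
  have h3 : 1 ≤ a / b := Nat.div_pos hab hb
  nlinarith [Nat.mul_le_mul_left (a / b * b) ht, Nat.mul_le_mul_right b h3]

/-- The lower bound `k ^ (2 * r + 1) / t ^ E` for `r + 1` colours, where `t` may be any
fixed power of `k` with positive exponent. -/
theorem exists_not_forcesWave (r : ℕ) : ∃ E : ℕ, ∀ s : ℕ, ∃ t₀ : ℕ, ∀ t ≥ t₀, ∀ k, 1 ≤ k →
    k ≤ t ^ s → ∀ N, N * t ^ E ≤ k ^ (2 * r + 1) → ¬ForcesWave k (r + 1) N := by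
  induction r with
  | zero =>
    refine ⟨1, fun s ↦ ⟨2, fun t ht k hk _ N hN hf ↦ ?_⟩⟩
    have := hf.le
    simp only [mul_zero, zero_add, pow_one] at hN
    nlinarith
  | succ r ih =>
    obtain ⟨E, hE⟩ := ih
    -- The factor `2 * r + 3` makes `k ≥ t ^ (E + 20)` whenever the claim is about some `N > 0`.
    refine ⟨(2 * r + 3) * (E + 20), fun s ↦ ?_⟩
    obtain ⟨t₁, ht₁⟩ := hE s
    obtain ⟨t₂, ht₂⟩ := exists_meetsAllColors_of_large (r + 1) (2 * s)
    refine ⟨max (max t₁ t₂) 7, fun t ht k hk hks N hN hf ↦ ?_⟩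
    have htt₁ : t₁ ≤ t := (le_max_left _ _).trans (le_of_max_le_left ht)
    have htt₂ : t₂ ≤ t := (le_max_right _ _).trans (le_of_max_le_left ht)
    have ht7 : 7 ≤ t := le_of_max_le_right ht
    have hN0 : 0 < N := hk.trans hf.le
    have hkt : t ^ (E + 20) ≤ k := by
      have h1 : t ^ ((2 * r + 3) * (E + 20)) ≤ k ^ (2 * (r + 1) + 1) :=
        (Nat.le_mul_of_pos_left _ hN0).trans hN
      rw [mul_comm (2 * r + 3), pow_mul] at h1
      exact (Nat.pow_le_pow_iff_left (by omega)).1 h1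
    have hpow : ∀ {a b : ℕ}, a ≤ b → t ^ a ≤ t ^ b := fun h ↦ Nat.pow_le_pow_right (by omega) h
    have htpos : ∀ a, 0 < t ^ a := fun a ↦ by positivity
    have hkt' : ∀ a ≤ 20, t ^ a ≤ k := fun a ha ↦ (hpow (by omega)).trans hkt
    set k' := k / t ^ 2 with hk'
    set B := k' ^ (2 * r + 1) / t ^ E with hB
    set M := k ^ 2 / t ^ 14 with hM
    set P := k / t ^ 5 with hP
    set S := k / t ^ 2 with hS
    set δ := B / t ^ 4 with hδ
    have hk'big : t ^ (E + 18) ≤ k' := by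
      rw [hk', Nat.le_div_iff_mul_le (htpos 2), ← pow_add]
      exact hkt
    have hk'pow : t ^ (E + 18) ≤ k' ^ (2 * r + 1) :=
      hk'big.trans (Nat.le_self_pow (by omega) _)
    have hBbig : t ^ 4 ≤ B := by
      rw [hB, Nat.le_div_iff_mul_le (htpos E), ← pow_add]
      exact (hpow (by omega)).trans hk'pow
    have e1 : k ≤ k' * t ^ 3 := le_div_mul_mul (htpos 2) (hkt' 2 (by omega)) (by omega)
    have e2 : k' ^ (2 * r + 1) ≤ B * t ^ (E + 1) :=
      le_div_mul_mul (htpos E) ((hpow (by omega)).trans hk'pow) (by omega)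
    have e3 : k ^ 2 ≤ M * t ^ 15 := le_div_mul_mul (htpos 14)
      ((hkt' 14 (by omega)).trans (Nat.le_self_pow two_ne_zero k)) (by omega)
    have e4 : k ≤ P * t ^ 6 := le_div_mul_mul (htpos 5) (hkt' 5 (by omega)) (by omega)
    have e5 : k ≤ S * t ^ 3 := e1
    have e6 : B ≤ δ * t ^ 5 := le_div_mul_mul (htpos 4) hBbig (by omega)
    have hNBM : N ≤ B * M := by
      refine Nat.le_of_mul_le_mul_right (c := t ^ ((2 * r + 3) * (E + 20))) ?_ (htpos _)
      calc N * t ^ ((2 * r + 3) * (E + 20)) ≤ k ^ (2 * r + 1) * k ^ 2 := by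
            rw [← pow_add]; exact hN
        _ ≤ (k' * t ^ 3) ^ (2 * r + 1) * (M * t ^ 15) := by gcongr
        _ = k' ^ (2 * r + 1) * (M * t ^ 15 * t ^ (3 * (2 * r + 1))) := by ring
        _ ≤ B * t ^ (E + 1) * (M * t ^ 15 * t ^ (3 * (2 * r + 1))) := by gcongr
        _ = B * M * t ^ (E + 1 + 15 + 3 * (2 * r + 1)) := by ring
        _ ≤ _ := Nat.mul_le_mul_left _ (hpow (by nlinarith))
    have hBM : B * M ≤ S * (P * δ) := by
      refine Nat.le_of_mul_le_mul_right (c := t ^ 14) ?_ (htpos _)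
      calc B * M * t ^ 14 = B * (M * t ^ 14) := by ring
        _ ≤ B * k ^ 2 := by gcongr; exact Nat.div_mul_le_self _ _
        _ = k * (k * B) := by ring
        _ ≤ S * t ^ 3 * (P * t ^ 6 * (δ * t ^ 5)) := by gcongr
        _ = S * (P * δ) * t ^ 14 := by ring
    have hlen : t * k' + P * (3 * t ^ 3) + S + 1 < k := by
      have a1 : k' * t ^ 2 ≤ k := Nat.div_mul_le_self _ _
      have a2 : P * t ^ 5 ≤ k := Nat.div_mul_le_self _ _
      have a3 : P * t ^ 4 ≤ P * t ^ 5 := Nat.mul_le_mul_left _ (hpow (by omega))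
      have a4 : S * t ^ 1 ≤ S * t ^ 2 := Nat.mul_le_mul_left _ (hpow (by omega))
      have a0 : S * t ^ 2 ≤ k := Nat.div_mul_le_self _ _
      have a5 : t ^ 1 ≤ k := hkt' 1 (by omega)
      have a6 : t * (t * k' + P * (3 * t ^ 3) + S + 1) ≤ 6 * k := by
        calc t * (t * k' + P * (3 * t ^ 3) + S + 1) =
            k' * t ^ 2 + 3 * (P * t ^ 4) + S * t ^ 1 + t ^ 1 := by ring
          _ ≤ 6 * k := by omega
      nlinarith
    have hMs : M ≤ t ^ (2 * s) := by
      calc M ≤ k ^ 2 := Nat.div_le_self _ _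
        _ ≤ (t ^ s) ^ 2 := by gcongr
        _ = t ^ (2 * s) := by ring
    obtain ⟨c, hc⟩ := ht₂ t htt₂
    refine not_forcesWave_of_blocks ht7 ((htpos 4).trans_le hBbig)
      (hc.anti (by exact_mod_cast hMs)) ?_ (Nat.div_mul_le_self _ _) hlen hBM (hf.mono hNBM)
    exact ht₁ t htt₁ k' ((htpos _).trans_le hk'big) ((Nat.div_le_self _ _).trans hks) B
      (Nat.div_mul_le_self _ _)

/-- Taking `t = ⌈k ^ (1 / s)⌉` with `s` large, both `t ^ E` and all constant factors are absorbed
by `k ^ ε`. -/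
lemma rpow_le_AW (r : ℕ) {ε : ℝ} (hε : 0 < ε) :
    ∃ k₀ : ℕ, ∀ k : ℕ, k₀ ≤ k → (k : ℝ) ^ (2 * (r : ℝ) + 1 - ε) ≤ AW k (r + 1) := by
  obtain ⟨E, hE⟩ := exists_not_forcesWave r
  obtain ⟨s, hs⟩ := exists_nat_ge (2 * E / ε + 1)
  have hs0 : 0 < (s : ℝ) := lt_of_lt_of_le (by positivity) hs
  have hEs : (E : ℝ) / s ≤ ε / 2 := by
    rw [div_le_iff₀ hs0]
    have h1 : 2 * E / ε ≤ (s : ℝ) := by linarith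
    rw [div_le_iff₀ hε] at h1
    linarith
  obtain ⟨t₀, ht₀⟩ := hE s
  have lim : ∀ a : ℝ, 0 < a → Filter.Tendsto (fun k : ℕ ↦ (k : ℝ) ^ a) Filter.atTop Filter.atTop :=
    fun a ha ↦ (tendsto_rpow_atTop ha).comp tendsto_natCast_atTop_atTop
  obtain ⟨k₀, hk₀⟩ := Filter.eventually_atTop.1 (((lim (1 / s) (by positivity)).eventually_ge_atTop
    (t₀ : ℝ)).and ((lim (ε / 2) (by positivity)).eventually_ge_atTop ((2 : ℝ) ^ E)))
  refine ⟨max k₀ 1, fun k hk ↦ ?_⟩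
  obtain ⟨h1, h2⟩ := hk₀ k (le_of_max_le_left hk)
  have hk1 : 1 ≤ k := le_of_max_le_right hk
  have hk1R : (1 : ℝ) ≤ k := by exact_mod_cast hk1
  have hk0R : (0 : ℝ) < k := by linarith
  set t := ⌈(k : ℝ) ^ (1 / (s : ℝ))⌉₊ with ht
  have hroot1 : (1 : ℝ) ≤ (k : ℝ) ^ (1 / (s : ℝ)) := Real.one_le_rpow hk1R (by positivity)
  have hroot : ((k : ℝ) ^ (1 / (s : ℝ))) ^ s = k := by
    rw [← Real.rpow_mul_natCast hk0R.le, one_div_mul_cancel hs0.ne', Real.rpow_one]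
  have htge : (k : ℝ) ^ (1 / (s : ℝ)) ≤ t := Nat.le_ceil _
  have htle : (t : ℝ) ≤ 2 * (k : ℝ) ^ (1 / (s : ℝ)) := by
    have := Nat.ceil_lt_add_one (show 0 ≤ (k : ℝ) ^ (1 / (s : ℝ)) by positivity)
    linarith
  have hkt : k ≤ t ^ s := by
    have : (k : ℝ) ≤ (t : ℝ) ^ s := by
      calc (k : ℝ) = ((k : ℝ) ^ (1 / (s : ℝ))) ^ s := hroot.symm
        _ ≤ _ := by gcongr
    exact_mod_cast this
  have hforce : ForcesWave k (r + 1) (AW k (r + 1)) :=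
    (Nat.sInf_mem (s := {N : ℕ | 0 < N ∧ ForcesWave k (r + 1) N}) (exists_forcesWave k (r + 1))).2
  have hlt : k ^ (2 * r + 1) < AW k (r + 1) * t ^ E := by
    by_contra! hcon
    exact ht₀ t (by exact_mod_cast h1.trans htge) k hk1 hkt _ hcon hforce
  have hltR : (k : ℝ) ^ (2 * r + 1) < AW k (r + 1) * (t : ℝ) ^ E := by exact_mod_cast hlt
  have htE : (t : ℝ) ^ E ≤ (k : ℝ) ^ ε := by
    calc (t : ℝ) ^ E ≤ (2 * (k : ℝ) ^ (1 / (s : ℝ))) ^ E := by gcongr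
      _ = 2 ^ E * (k : ℝ) ^ ((E : ℝ) / s) := by
        rw [mul_pow, ← Real.rpow_mul_natCast hk0R.le, one_div_mul_eq_div]
      _ ≤ (k : ℝ) ^ (ε / 2) * (k : ℝ) ^ (ε / 2) := by
        gcongr
      _ = (k : ℝ) ^ ε := by rw [← Real.rpow_add hk0R, add_halves]
  rw [Real.rpow_sub hk0R, div_le_iff₀ (by positivity)]
  calc (k : ℝ) ^ (2 * (r : ℝ) + 1) = (k : ℝ) ^ (2 * r + 1) := by
        rw [← Real.rpow_natCast]; push_cast; rfl
    _ ≤ AW k (r + 1) * (t : ℝ) ^ E := hltR.le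
    _ ≤ _ := by gcongr

theorem theorem2 (r : ℕ) (hr : 1 ≤ r) (ε : ℝ) (hε : 0 < ε) :
    ∃ k₀ : ℕ, ∀ k : ℕ, k₀ ≤ k →
      (AW k r : ℝ) ≥
        (k : ℝ) ^ (2 * (r : ℝ) - 1 - ε) / ((2 : ℝ) ^ (r - 1) * (40 * (r : ℝ)) ^ (r ^ 2 - 1)) := by
  obtain ⟨r, rfl⟩ := Nat.exists_eq_add_of_le' hr
  obtain ⟨k₀, hk₀⟩ := rpow_le_AW r hε
  -- The denominator is at least `1`, and the bound holds without it.
  refine ⟨k₀, fun k hk ↦ le_trans (div_le_self (by positivity) ?_) ?_⟩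
  · refine one_le_mul_of_one_le_of_one_le (one_le_pow₀ one_le_two) (one_le_pow₀ ?_)
    push_cast
    linarith [(Nat.cast_nonneg r : (0 : ℝ) ≤ r)]
  · have e : 2 * ((r + 1 : ℕ) : ℝ) - 1 - ε = 2 * (r : ℝ) + 1 - ε := by
      push_cast
      ring
    rw [e]
    exact hk₀ k hk
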